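/- Let $I$ be an infinite set and let $c_0(I)$ be the real Banach lattice of all functions $x : I \to \mathbb{R}$ such that $\{i \in I : |x_i| \ge \varepsilon\}$ is finite for every $\varepsilon > 0$, with the supremum norm and the pointwise order; write $c_0 = c_0(\mathbb{N})$. For a real Banach lattice $E$ with dual Banach lattice $E'$, every bounded linear operator $T : E \to c_0$ has the form $T(x) = (x_n'(x))_n$ for a unique weak* null sequence $(x_n')$ in $E'$; $T$ is called disjoint if $|x_n'| \wedge |x_m'| = 0$ in $E'$ whenever $n \ne m$. A set $A \subseteq E$ is called almost Grothendieck if $T(A)$ is relatively weakly compact in $c_0$ for every disjoint operator $T : E \to c_0$. The solid hull of $A$ is $\mathrm{sol}(A) = \{y \in E : |y| \le |x| \text{ for some } x \in A\}$. Then: 1. $c_0(I)$ has order continuous norm, that is, $\|x_\alpha\| \to 0$ for every net with $x_\alpha \downarrow 0$ in $c_0(I)$; 2. every almost Grothendieck set in $c_0(I)$ is relatively weakly compact; 3. the lattice operations in $c_0(I)$ are weakly sequentially continuous, that is, if $x_n \to 0$ weakly in $c_0(I)$, then $|x_n| \to 0$ weakly in $c_0(I)$. Consequently, 4. if $A \subseteq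 c_0(I)$ is almost Grothendieck, then its solid hull $\mathrm{sol}(A)$ is almost Grothendieck. -/

import Mathlib

open Filter Topology
open scoped ZeroAtInfty

universe u

/-! ### Banach lattices -/

/-- A (real) Banach lattice: a complete normed real vector space with a lattice order that is
compatible with addition and with multiplication by nonnegative scalars, and whose norm is monotone
with respect to the modulus. -/
class IsBanachLattice (E : Type u) [NormedAddCommGroup E] [NormedSpace ℝ E] [Lattice E] : Prop
    extends CompleteSpace E, IsOrderedAddMonoid E, PosSMulMono ℝ E, HasSolidNorm E

section Definitions

variable (E : Type u) [NormedAddCommGroup E] [NormedSpace ℝ E] [Lattice E]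

variable {E} in
/-- The order of the dual Banach lattice `E'`: `f ≤ g` iff `f x ≤ g x` for every `x ≥ 0`. -/
def DualLE (f g : StrongDual ℝ E) : Prop :=
  ∀ x : E, 0 ≤ x → f x ≤ g x

variable {E} in
/-- `m` is the modulus `|f| = f ⊔ (-f)` of `f` in the dual Banach lattice `E'`. -/
def IsDualModulus (f m : StrongDual ℝ E) : Prop :=
  DualLE f m ∧ DualLE (-f) m ∧ ∀ h : StrongDual ℝ E, DualLE f h → DualLE (-f) h → DualLE m h

variable {E} in
/-- `m` is the infimum `f ⊓ g` of `f` and `g` in the dual Banach lattice `E'`. -/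
def IsDualInf (f g m : StrongDual ℝ E) : Prop :=
  DualLE m f ∧ DualLE m g ∧ ∀ h : StrongDual ℝ E, DualLE h f → DualLE h g → DualLE h m

variable {E} in
/-- `f` and `g` are disjoint in the dual Banach lattice `E'`: `|f| ⊓ |g| = 0`. -/
def DualDisjoint (f g : StrongDual ℝ E) : Prop :=
  ∃ mf mg : StrongDual ℝ E, IsDualModulus f mf ∧ IsDualModulus g mg ∧ IsDualInf mf mg 0

variable {E} in
/-- A bounded linear operator `T : E → c₀` is disjoint if the weak* null sequence `(x'ₙ)` in `E'`
with `T x = (x'ₙ(x))ₙ` for all `x` is a disjoint sequence of the dual Banach lattice. (The sequence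
is determined by `T`, and it is weak* null because `T` takes its values in `c₀`.) -/
def IsDisjointOperator (T : E →L[ℝ] C₀(ℕ, ℝ)) : Prop :=
  ∃ x' : ℕ → StrongDual ℝ E, (∀ (x : E) (n : ℕ), T x n = x' n x) ∧
    ∀ m n : ℕ, m ≠ n → DualDisjoint (x' m) (x' n)

/-- A subset of a normed space is relatively weakly compact if its weak closure is weakly
compact. -/
def IsRelativelyWeaklyCompact {X : Type u} [NormedAddCommGroup X] [NormedSpace ℝ X]
    (A : Set X) : Prop :=
  IsCompact (closure (toWeakSpace ℝ X '' A))

variable {E} in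
/-- `A ⊆ E` is an almost Grothendieck set if `T(A)` is relatively weakly compact in `c₀` for every
disjoint operator `T : E → c₀`. -/
def IsAlmostGrothendieck [IsBanachLattice E] (A : Set E) : Prop :=
  ∀ T : E →L[ℝ] C₀(ℕ, ℝ), IsDisjointOperator T → IsRelativelyWeaklyCompact (T '' A)

/-- `E` has order continuous norm: `x_i ↓ 0` implies `‖x_i‖ → 0` for every net `(x_i)` in `E`.
(A decreasing net can be replaced by its range, a directed subset of `E`, so that index sets in
the universe of `E` suffice.) -/
def HasOrderContinuousNorm [IsBanachLattice E] : Prop :=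
  ∀ (ι : Type u) [Preorder ι] [IsDirectedOrder ι] [Nonempty ι] (x : ι → E),
    Antitone x → IsGLB (Set.range x) 0 → Tendsto (fun i => ‖x i‖) atTop (𝓝 0)

/-- The lattice operations of `E` are weakly sequentially continuous: if `x_n → 0` weakly then
`|x_n| → 0` weakly. -/
def HasWeaklySeqContinuousLatticeOps [IsBanachLattice E] : Prop :=
  ∀ x : ℕ → E, Tendsto (fun n => toWeakSpace ℝ E (x n)) atTop (𝓝 (toWeakSpace ℝ E 0)) →
    Tendsto (fun n => toWeakSpace ℝ E |x n|) atTop (𝓝 (toWeakSpace ℝ E 0))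

end Definitions

/-! ### The Banach lattice `c₀(I)`

For a discrete space `I`, the space `C₀(I, ℝ)` of functions `x : I → ℝ` such that
`{i | ε ≤ |x i|}` is finite for all `ε > 0`, with the supremum norm. It is ordered pointwise. -/

section CZero

variable {I : Type u} [TopologicalSpace I]

noncomputable instance : Max C₀(I, ℝ) where
  max f g :=
    { toFun := fun i => f i ⊔ g i
      continuous_toFun := (map_continuous f).sup (map_continuous g)
      zero_at_infty' := by
        simpa using (zero_at_infty f).sup_nhds (zero_at_infty g) }

noncomputable instance : Min C₀(I, ℝ) where
  min f g :=
    { toFun := fun i => f i ⊓ g i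
      continuous_toFun := (map_continuous f).inf (map_continuous g)
      zero_at_infty' := by
        simpa using (zero_at_infty f).inf_nhds (zero_at_infty g) }

instance : LE C₀(I, ℝ) := ⟨fun f g => ∀ i, f i ≤ g i⟩

instance : LT C₀(I, ℝ) := ⟨fun f g => f ≤ g ∧ ¬ g ≤ f⟩

noncomputable instance : Lattice C₀(I, ℝ) where
  le := (· ≤ ·)
  lt := (· < ·)
  sup := max
  inf := min
  le_refl _ _ := le_rfl
  le_trans _ _ _ h₁ h₂ i := (h₁ i).trans (h₂ i)
  lt_iff_le_not_ge _ _ := Iff.rfl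
  le_antisymm _ _ h₁ h₂ := ZeroAtInftyContinuousMap.ext fun i => (h₁ i).antisymm (h₂ i)
  le_sup_left f g i := show f i ≤ f i ⊔ g i from le_sup_left
  le_sup_right f g i := show g i ≤ f i ⊔ g i from le_sup_right
  sup_le f g _ h₁ h₂ i := show f i ⊔ g i ≤ _ from sup_le (h₁ i) (h₂ i)
  inf_le_left f g i := show f i ⊓ g i ≤ f i from inf_le_left
  inf_le_right f g i := show f i ⊓ g i ≤ g i from inf_le_right
  le_inf _ f g h₁ h₂ i := show _ ≤ f i ⊓ g i from le_inf (h₁ i) (h₂ i)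

theorem czero_le_iff (f g : C₀(I, ℝ)) : f ≤ g ↔ ∀ i, f i ≤ g i := Iff.rfl

theorem czero_abs_apply (f : C₀(I, ℝ)) (i : I) : |f| i = |f i| := rfl

theorem czero_norm_le_iff (f : C₀(I, ℝ)) {C : ℝ} (hC : 0 ≤ C) : ‖f‖ ≤ C ↔ ∀ i, |f i| ≤ C := by
  rw [← ZeroAtInftyContinuousMap.norm_toBCF_eq_norm, BoundedContinuousFunction.norm_le hC]
  rfl

instance : IsBanachLattice C₀(I, ℝ) where
  complete := CompleteSpace.complete
  add_le_add_left _ _ h c i := add_le_add_left (h i) (c i)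
  smul_le_smul_of_nonneg_left _ ha _ _ h i := mul_le_mul_of_nonneg_left (h i) ha
  solid f g h := (czero_norm_le_iff f (norm_nonneg g)).2 fun i =>
    (h i).trans ((czero_norm_le_iff g (norm_nonneg g)).1 le_rfl i)

end CZero

/-! ### Weak convergence and weak compactness -/

section Weak

variable {X Y : Type*} [NormedAddCommGroup X] [NormedSpace ℝ X]
  [NormedAddCommGroup Y] [NormedSpace ℝ Y]

theorem tendsto_toWeakSpace_iff {ι : Type*} {l : Filter ι} {x : ι → X} {a : X} :
    Tendsto (fun n => toWeakSpace ℝ X (x n)) l (𝓝 (toWeakSpace ℝ X a)) ↔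
      ∀ φ : StrongDual ℝ X, Tendsto (fun n => φ (x n)) l (𝓝 (φ a)) := by
  have h : Topology.IsInducing fun (y : WeakSpace ℝ X) (φ : StrongDual ℝ X) =>
      φ ((toWeakSpace ℝ X).symm y) := ⟨rfl⟩
  rw [h.tendsto_nhds_iff, tendsto_pi_nhds]
  rfl

theorem continuous_toWeakSpace_comp {Z : Type*} [TopologicalSpace Z] {g : Z → X}
    (h : ∀ φ : StrongDual ℝ X, Continuous fun z => φ (g z)) :
    Continuous fun z => toWeakSpace ℝ X (g z) :=
  continuous_iff_continuousAt.2 fun _ =>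
    tendsto_toWeakSpace_iff.2 fun φ => (h φ).continuousAt

theorem continuous_weakSpace_eval (φ : StrongDual ℝ X) :
    Continuous fun x : WeakSpace ℝ X => φ ((toWeakSpace ℝ X).symm x) :=
  WeakBilin.eval_continuous _ φ

theorem exists_norm_le_of_forall_dual {ι : Type*} {x : ι → X}
    (h : ∀ φ : StrongDual ℝ X, ∃ C, ∀ i, |φ (x i)| ≤ C) : ∃ C, ∀ i, ‖x i‖ ≤ C := by
  obtain ⟨C, hC⟩ := banach_steinhaus (g := fun i => NormedSpace.inclusionInDoubleDual ℝ X (x i)) h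
  refine ⟨C, fun i => ?_⟩
  rw [← (NormedSpace.inclusionInDoubleDualLi ℝ (E := X)).norm_map (x i)]
  exact hC i

theorem IsRelativelyWeaklyCompact.of_subset {K : Set (WeakSpace ℝ X)} (hK : IsCompact K)
    {A : Set X} (h : toWeakSpace ℝ X '' A ⊆ K) : IsRelativelyWeaklyCompact A :=
  hK.closure_of_subset h

theorem IsRelativelyWeaklyCompact.image {A : Set X} (hA : IsRelativelyWeaklyCompact A)
    (T : X →L[ℝ] Y) : IsRelativelyWeaklyCompact (T '' A) := by
  refine .of_subset (IsCompact.image hA (WeakSpace.map T).continuous) ?_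
  rintro _ ⟨_, ⟨x, hx, rfl⟩, rfl⟩
  exact ⟨toWeakSpace ℝ X x, subset_closure ⟨x, hx, rfl⟩, rfl⟩

theorem IsRelativelyWeaklyCompact.exists_norm_le {A : Set X} (hA : IsRelativelyWeaklyCompact A) :
    ∃ C, ∀ x ∈ A, ‖x‖ ≤ C := by
  obtain ⟨C, hC⟩ := exists_norm_le_of_forall_dual (x := fun a : A => (a : X)) fun φ => by
    obtain ⟨C, hC⟩ := IsCompact.exists_bound_of_continuousOn hA
      (continuous_weakSpace_eval φ).continuousOn
    exact ⟨C, fun a => hC _ (subset_closure ⟨a, a.2, rfl⟩)⟩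
  exact ⟨C, fun x hx => hC ⟨x, hx⟩⟩

end Weak

theorem exists_injective_range_superset {I : Type*} [Infinite I] (i : ℕ → I) :
    ∃ j : ℕ → I, Function.Injective j ∧ ∀ n, ∃ k, j k = i n := by
  set S : Set I := Set.range i ∪ Set.range (Infinite.natEmbedding I)
  have hc : S.Countable := (Set.countable_range _).union (Set.countable_range _)
  have hi : S.Infinite :=
    (Set.infinite_range_of_injective (Infinite.natEmbedding I).injective).mono
      Set.subset_union_right
  have := hc.to_subtype
  have := hi.to_subtype
  obtain ⟨e⟩ := nonempty_equiv_of_countable (α := ℕ) (β := S)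
  exact ⟨fun n => e n, Subtype.val_injective.comp e.injective,
    fun n => ⟨e.symm ⟨i n, .inl ⟨n, rfl⟩⟩, by simp⟩⟩

/-! ### Functionals and weak topology on `c₀(I)` -/

namespace CZero

variable {I : Type u} [TopologicalSpace I]

theorem abs_apply_le_norm (x : C₀(I, ℝ)) (i : I) : |x i| ≤ ‖x‖ :=
  (czero_norm_le_iff x (norm_nonneg x)).1 le_rfl i

/-- The evaluation functional at `i`. -/
noncomputable def eval (i : I) : StrongDual ℝ C₀(I, ℝ) :=
  LinearMap.mkContinuous
    { toFun := fun x => x i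
      map_add' := fun _ _ => rfl
      map_smul' := fun _ _ => rfl } 1 fun x => by
    rw [one_mul]
    exact abs_apply_le_norm x i

@[simp] theorem eval_apply (i : I) (x : C₀(I, ℝ)) : eval i x = x i := rfl

theorem sum_apply (s : Finset I) (f : I → C₀(I, ℝ)) (k : I) :
    (∑ i ∈ s, f i) k = ∑ i ∈ s, f i k :=
  map_sum (eval k) f s

theorem isDualModulus_eval (i : I) : IsDualModulus (eval i) (eval i) :=
  ⟨fun _ _ => le_rfl, fun _ hx => neg_le_self (hx i), fun _ h _ => h⟩

/-- A set in `c₀(I)` contained in a bounded, pointwise compact set of null functions. -/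
def PointwisePrecompact (A : Set C₀(I, ℝ)) : Prop :=
  ∃ (P : Set (I → ℝ)) (C : ℝ), IsCompact P ∧ (∀ p ∈ P, ∀ i, |p i| ≤ C) ∧
    (∀ p ∈ P, Tendsto p cofinite (𝓝 0)) ∧ ∀ x ∈ A, (x : I → ℝ) ∈ P

theorem PointwisePrecompact.solidClosure {A : Set C₀(I, ℝ)} (hA : PointwisePrecompact A) :
    PointwisePrecompact (LatticeOrderedAddCommGroup.solidClosure A) := by
  obtain ⟨P, C, hP, hC, h0, hAP⟩ := hA
  have hbox : IsCompact (Set.univ.pi fun _ : I => Set.Icc (-C) C) :=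
    isCompact_univ_pi fun _ => isCompact_Icc
  have hclosed : IsClosed {q : (I → ℝ) × (I → ℝ) | ∀ i, |q.1 i| ≤ |q.2 i|} := by
    simp only [Set.ofPred_forall]
    exact isClosed_iInter fun i => isClosed_le (by fun_prop) (by fun_prop)
  refine ⟨_, C, ((hbox.prod hP).inter_right hclosed).image continuous_fst, ?_, ?_, ?_⟩
  · rintro _ ⟨⟨q, p⟩, ⟨⟨-, hp⟩, hqp⟩, rfl⟩ i
    exact (hqp i).trans (hC p hp i)
  · rintro _ ⟨⟨q, p⟩, ⟨⟨-, hp⟩, hqp⟩, rfl⟩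
    exact squeeze_zero_norm hqp (by simpa using (h0 p hp).abs)
  · rintro y ⟨x, hx, hyx⟩
    exact ⟨(y, x), ⟨⟨fun i _ => abs_le.1 ((hyx i).trans (hC x (hAP x hx) i)), hAP x hx⟩, hyx⟩, rfl⟩

variable [DiscreteTopology I]

theorem tendsto_cofinite (x : C₀(I, ℝ)) : Tendsto x cofinite (𝓝 0) := by
  simpa [cocompact_eq_cofinite] using zero_at_infty x

/-- A function tending to zero along the cofinite filter, as an element of `c₀(I)`. -/
def ofTendsto (p : I → ℝ) (h : Tendsto p cofinite (𝓝 0)) : C₀(I, ℝ) where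
  toFun := p
  continuous_toFun := continuous_of_discreteTopology
  zero_at_infty' := by rwa [cocompact_eq_cofinite]

@[simp] theorem ofTendsto_apply (p : I → ℝ) (h : Tendsto p cofinite (𝓝 0)) (i : I) :
    ofTendsto p h i = p i := rfl

open Classical in
/-- The element of `c₀(I)` with value `c` at `i` and zero elsewhere. -/
noncomputable def single (i : I) (c : ℝ) : C₀(I, ℝ) :=
  ofTendsto (Pi.single i c) <| tendsto_const_nhds.congr' <| by
    filter_upwards [(Set.finite_singleton i).compl_mem_cofinite] with k hk
    exact (Pi.single_eq_of_ne (M := fun _ : I => ℝ) hk c).symm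

open Classical in
theorem single_apply (i : I) (c : ℝ) (k : I) : single i c k = if k = i then c else 0 :=
  Pi.single_apply i c k

@[simp] theorem single_same (i : I) (c : ℝ) : single i c i = c := by simp [single_apply]

theorem single_of_ne {i k : I} (h : k ≠ i) (c : ℝ) : single i c k = 0 := by simp [single_apply, h]

theorem smul_single (i : I) (c d : ℝ) : c • single i d = single i (c * d) := by
  ext k
  simp [single_apply]

open Classical in
theorem sum_single_apply (s : Finset I) (c : I → ℝ) (k : I) :
    (∑ i ∈ s, single i (c i)) k = if k ∈ s then c k else 0 := by
  simp [sum_apply, single_apply]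

theorem hasSum_single (x : C₀(I, ℝ)) : HasSum (fun i => single i (x i)) x := by
  classical
  rw [HasSum, SummationFilter.unconditional_filter, Metric.tendsto_nhds]
  intro ε hε
  have hfin : {i | ¬ |x i| < ε / 2}.Finite := by
    have := (tendsto_cofinite x).abs.eventually_lt_const (u := ε / 2) (by simpa using half_pos hε)
    exact this
  filter_upwards [eventually_ge_atTop hfin.toFinset] with s hs
  rw [dist_eq_norm]
  refine lt_of_le_of_lt ((czero_norm_le_iff _ (half_pos hε).le).2 fun k => ?_) (half_lt_self hε)
  rw [ZeroAtInftyContinuousMap.sub_apply, sum_single_apply]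
  split_ifs with hk
  · simpa using (half_pos hε).le
  · have : k ∉ hfin.toFinset := fun h => hk (hs h)
    rw [zero_sub, abs_neg]
    rw [Set.Finite.mem_toFinset] at this
    exact (not_not.1 this).le

theorem summable_abs_functional (φ : StrongDual ℝ C₀(I, ℝ)) :
    Summable fun i => |φ (single i 1)| := by
  classical
  refine summable_of_sum_le (c := ‖φ‖) (fun _ => abs_nonneg _) fun s => ?_
  set c : I → ℝ := fun i => SignType.sign (φ (single i 1))
  have h : ∑ i ∈ s, |φ (single i 1)| = φ (∑ i ∈ s, single i (c i)) := by
    rw [map_sum]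
    refine Finset.sum_congr rfl fun i _ => ?_
    rw [← mul_one (c i), ← smul_single, map_smul, smul_eq_mul]
    exact (sign_mul_self _).symm
  have hn : ‖∑ i ∈ s, single i (c i)‖ ≤ 1 := by
    refine (czero_norm_le_iff _ zero_le_one).2 fun k => ?_
    rw [sum_single_apply]
    split_ifs
    · rcases lt_trichotomy (φ (single k 1)) 0 with h | h | h <;> simp [c, h]
    · simp
  rw [h]
  exact (le_abs_self _).trans ((φ.le_opNorm _).trans (mul_le_of_le_one_right (norm_nonneg φ) hn))

theorem functional_eq_tsum (φ : StrongDual ℝ C₀(I, ℝ)) (x : C₀(I, ℝ)) :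
    φ x = ∑' i, φ (single i 1) * x i := by
  refine ((hasSum_single x).mapL φ).tsum_eq.symm.trans (tsum_congr fun i => ?_)
  rw [← mul_one (x i), ← smul_single, map_smul, smul_eq_mul, mul_one, mul_comm]

theorem abs_functional_term_le (φ : StrongDual ℝ C₀(I, ℝ)) {C t : ℝ} (h : |t| ≤ C) (i : I) :
    ‖φ (single i 1) * t‖ ≤ |φ (single i 1)| * C := by
  rw [Real.norm_eq_abs, abs_mul]
  exact mul_le_mul_of_nonneg_left h (abs_nonneg _)

/-- On bounded sequences, pointwise convergence implies weak convergence. -/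
theorem tendsto_weak_of_pointwise {x : ℕ → C₀(I, ℝ)} {a : C₀(I, ℝ)} {C : ℝ}
    (hC : ∀ n i, |x n i| ≤ C) (h : ∀ i, Tendsto (fun n => x n i) atTop (𝓝 (a i))) :
    Tendsto (fun n => toWeakSpace ℝ C₀(I, ℝ) (x n)) atTop (𝓝 (toWeakSpace ℝ C₀(I, ℝ) a)) := by
  refine tendsto_toWeakSpace_iff.2 fun φ => ?_
  rw [functional_eq_tsum φ a]
  refine Tendsto.congr (fun n => (functional_eq_tsum φ (x n)).symm) ?_
  exact tendsto_tsum_of_dominated_convergence ((summable_abs_functional φ).mul_right C)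
    (fun i => (h i).const_mul _) (.of_forall fun n i => abs_functional_term_le φ (hC n i) i)

/-! ### Pointwise relative compactness -/

theorem PointwisePrecompact.isRelativelyWeaklyCompact {A : Set C₀(I, ℝ)}
    (hA : PointwisePrecompact A) : IsRelativelyWeaklyCompact A := by
  obtain ⟨P, C, hP, hC, h0, hAP⟩ := hA
  have := isCompact_iff_compactSpace.1 hP
  have hcont : Continuous fun p : P => toWeakSpace ℝ C₀(I, ℝ) (ofTendsto p.1 (h0 p.1 p.2)) := by
    refine continuous_toWeakSpace_comp fun φ => ?_
    refine Continuous.congr ?_ fun p => (functional_eq_tsum φ _).symm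
    exact continuous_tsum
      (fun i => continuous_const.mul ((continuous_apply i).comp continuous_subtype_val))
      ((summable_abs_functional φ).mul_right C)
      fun i p => abs_functional_term_le φ (hC p.1 p.2 i) i
  refine .of_subset (isCompact_range hcont) ?_
  rintro _ ⟨x, hx, rfl⟩
  exact ⟨⟨x, hAP x hx⟩, rfl⟩

/-! ### Coordinate operators -/

/-- The operator `x ↦ x ∘ j` for an injective map `j`. -/
noncomputable def compInjective (j : ℕ → I) (hj : Function.Injective j) :
    C₀(I, ℝ) →L[ℝ] C₀(ℕ, ℝ) :=
  LinearMap.mkContinuous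
    { toFun := fun x => ofTendsto (x ∘ j) ((tendsto_cofinite x).comp hj.tendsto_cofinite)
      map_add' := fun _ _ => rfl
      map_smul' := fun _ _ => rfl } 1 fun x => by
    rw [one_mul]
    exact (czero_norm_le_iff _ (norm_nonneg x)).2 fun n => abs_apply_le_norm x (j n)

@[simp] theorem compInjective_apply (j : ℕ → I) (hj : Function.Injective j) (x : C₀(I, ℝ))
    (n : ℕ) : compInjective j hj x n = x (j n) := rfl

theorem dualDisjoint_eval {i k : I} (h : i ≠ k) : DualDisjoint (eval i) (eval k) := by
  refine ⟨_, _, isDualModulus_eval i, isDualModulus_eval k, fun x hx => hx i, fun x hx => hx k,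
    fun f hi hk x hx => ?_⟩
  have h1 : f (single i (x i)) ≤ 0 := by
    refine (hk _ fun l => ?_).trans_eq (single_of_ne h.symm _)
    rw [single_apply]
    split_ifs
    exacts [hx i, le_rfl]
  have h2 : f (x - single i (x i)) ≤ 0 := by
    refine (hi _ fun l => ?_).trans_eq (by simp)
    rw [ZeroAtInftyContinuousMap.sub_apply, single_apply]
    split_ifs with hl
    · simp [hl]
    · simpa using hx l
  have := add_nonpos h1 h2
  rwa [← map_add, add_sub_cancel] at this

theorem isDisjointOperator_compInjective (j : ℕ → I) (hj : Function.Injective j) :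
    IsDisjointOperator (compInjective j hj) :=
  ⟨fun n => eval (j n), fun _ _ => rfl, fun _ _ h => dualDisjoint_eval (hj.ne h)⟩

theorem exists_norm_le_of_isAlmostGrothendieck [Infinite I] {A : Set C₀(I, ℝ)}
    (hA : IsAlmostGrothendieck A) : ∃ C, ∀ x ∈ A, ∀ i, |x i| ≤ C := by
  by_contra! h
  choose x hx i hi using fun n : ℕ => h n
  obtain ⟨j, hj, hji⟩ := exists_injective_range_superset i
  obtain ⟨C, hC⟩ := (hA _ (isDisjointOperator_compInjective j hj)).exists_norm_le
  obtain ⟨n, hn⟩ := exists_nat_ge C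
  obtain ⟨k, hk⟩ := hji n
  have := (abs_apply_le_norm _ k).trans (hC _ ⟨x n, hx n, rfl⟩)
  rw [compInjective_apply, hk] at this
  linarith [hi n]

/-- Pointwise limits of a relatively weakly compact set in `c₀` are null sequences. -/
theorem tendsto_zero_of_mem_closure {B : Set C₀(I, ℝ)} (hB : IsRelativelyWeaklyCompact B)
    {p : I → ℝ} (hp : p ∈ closure ((fun x : C₀(I, ℝ) => (x : I → ℝ)) '' B)) :
    Tendsto p cofinite (𝓝 0) := by
  have hcont : Continuous fun x : WeakSpace ℝ C₀(I, ℝ) =>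
      fun i => (toWeakSpace ℝ C₀(I, ℝ)).symm x i :=
    continuous_pi fun i => continuous_weakSpace_eval (eval i)
  have hsub := closure_minimal (s := (fun x : C₀(I, ℝ) => (x : I → ℝ)) '' B) (by
    rintro _ ⟨x, hx, rfl⟩
    exact ⟨_, subset_closure ⟨x, hx, rfl⟩, rfl⟩) (IsCompact.image hB hcont).isClosed
  obtain ⟨x, -, rfl⟩ := hsub hp
  exact tendsto_cofinite ((toWeakSpace ℝ C₀(I, ℝ)).symm x)

theorem pointwisePrecompact_of_isAlmostGrothendieck [Infinite I] {A : Set C₀(I, ℝ)}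
    (hA : IsAlmostGrothendieck A) : PointwisePrecompact A := by
  obtain ⟨C, hC⟩ := exists_norm_le_of_isAlmostGrothendieck hA
  have hbox : IsCompact (Set.univ.pi fun _ : I => Set.Icc (-C) C) :=
    isCompact_univ_pi fun _ => isCompact_Icc
  set S : Set (I → ℝ) := (fun x : C₀(I, ℝ) => (x : I → ℝ)) '' A
  have hsub : closure S ⊆ Set.univ.pi fun _ : I => Set.Icc (-C) C := by
    refine closure_minimal ?_ hbox.isClosed
    rintro _ ⟨x, hx, rfl⟩ i -
    exact abs_le.1 (hC x hx i)
  refine ⟨closure S, C, hbox.of_isClosed_subset isClosed_closure hsub,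
    fun p hp i => abs_le.2 (hsub hp i trivial), fun p hp => ?_,
    fun x hx => subset_closure ⟨x, hx, rfl⟩⟩
  rw [Metric.tendsto_nhds]
  intro ε hε
  by_contra hinf
  obtain ⟨j, hj⟩ : Nonempty (ℕ ↪ {i | ¬ dist (p i) 0 < ε}) :=
    ⟨Set.Infinite.natEmbedding _ hinf⟩
  have hinj : Function.Injective fun n => (j n : I) := Subtype.val_injective.comp hj
  have hr : Continuous fun q : I → ℝ => fun n => q (j n) := by fun_prop
  have hmem : (fun n => p (j n)) ∈ closure ((fun x : C₀(ℕ, ℝ) => (x : ℕ → ℝ)) ''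
      (compInjective _ hinj '' A)) := by
    refine map_mem_closure hr hp ?_
    rintro _ ⟨x, hx, rfl⟩
    exact ⟨_, ⟨x, hx, rfl⟩, rfl⟩
  have hlim := tendsto_zero_of_mem_closure (hA _ (isDisjointOperator_compInjective _ hinj)) hmem
  obtain ⟨n, hn⟩ := ((Metric.tendsto_nhds.1 hlim) ε hε).exists
  exact (j n).2 hn

/-! ### Order continuity of the norm and lattice operations -/

theorem hasOrderContinuousNorm : HasOrderContinuousNorm C₀(I, ℝ) := by
  intro ι _ _ _ x hx hglb
  have hpos : ∀ a i, 0 ≤ x a i := fun a => hglb.1 ⟨a, rfl⟩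
  have hlt : ∀ ε > 0, ∀ i, ∀ᶠ a in atTop, x a i < ε := by
    intro ε hε i
    suffices ∃ a, x a i < ε by
      obtain ⟨a, ha⟩ := this
      filter_upwards [eventually_ge_atTop a] with b hb
      exact (hx hb i).trans_lt ha
    by_contra! h
    have : single i ε ≤ 0 := hglb.2 <| by
      rintro _ ⟨a, rfl⟩ k
      rw [single_apply]
      split_ifs with hk
      exacts [hk ▸ h a, hpos a k]
    have := this i
    rw [single_same] at this
    exact this.not_gt hε
  rw [Metric.tendsto_nhds]
  intro ε hε
  obtain ⟨a₀⟩ := ‹Nonempty ι›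
  have hfin : {i | ¬ x a₀ i < ε / 2}.Finite :=
    (tendsto_cofinite (x a₀)).eventually_lt_const (half_pos hε)
  filter_upwards [eventually_ge_atTop a₀,
    (eventually_all_finite hfin).2 fun i _ => hlt _ (half_pos hε) i] with a ha hF
  rw [dist_zero_right, norm_norm]
  refine lt_of_le_of_lt ((czero_norm_le_iff _ (half_pos hε).le).2 fun i => ?_) (half_lt_self hε)
  rw [abs_of_nonneg (hpos a i)]
  by_cases hi : x a₀ i < ε / 2
  exacts [(hx ha i).trans hi.le, (hF i hi).le]

theorem hasWeaklySeqContinuousLatticeOps : HasWeaklySeqContinuousLatticeOps C₀(I, ℝ) := by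
  intro x hx
  rw [tendsto_toWeakSpace_iff] at hx
  obtain ⟨C, hC⟩ := exists_norm_le_of_forall_dual (x := x) fun φ => by
    obtain ⟨C, hC⟩ := (hx φ).abs.bddAbove_range
    exact ⟨C, fun n => hC ⟨n, rfl⟩⟩
  refine tendsto_weak_of_pointwise (C := C) (fun n i => ?_) fun i => ?_
  · rw [czero_abs_apply, abs_abs]
    exact (abs_apply_le_norm _ i).trans (hC n)
  · simpa [czero_abs_apply] using (hx (eval i)).abs

end CZero

theorem mainTheorem10 (I : Type u) [Infinite I] [TopologicalSpace I] [DiscreteTopology I] :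
    HasOrderContinuousNorm C₀(I, ℝ) ∧
    (∀ A : Set C₀(I, ℝ), IsAlmostGrothendieck A → IsRelativelyWeaklyCompact A) ∧
    HasWeaklySeqContinuousLatticeOps C₀(I, ℝ) ∧
    (∀ A : Set C₀(I, ℝ), IsAlmostGrothendieck A →
      IsAlmostGrothendieck (LatticeOrderedAddCommGroup.solidClosure A)) := by
  have hP {A : Set C₀(I, ℝ)} (hA : IsAlmostGrothendieck A) :=
    CZero.pointwisePrecompact_of_isAlmostGrothendieck hA
  exact ⟨CZero.hasOrderContinuousNorm, fun A hA => (hP hA).isRelativelyWeaklyCompact,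
    CZero.hasWeaklySeqContinuousLatticeOps,
    fun A hA T _ => (hP hA).solidClosure.isRelativelyWeaklyCompact.image T⟩
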